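/- Let $\mathbb S\subset\mathbb R$ be a finite set and let $\boldsymbol G=(G(x,y))_{x,y\in\mathbb S}$ be a transition rate matrix, i.e. $G(x,y)\ge 0$ for $x\ne y$ and $G(x,x)=-\sum_{y\ne x}G(x,y)$. Let $Y=(Y_t)_{t\ge 0}$ be the continuous-time Markov chain on $\mathbb S$ with right-continuous paths and rate matrix $\boldsymbol G$ (transition matrices $e^{t\boldsymbol G}$), and write $\mathbb E_x$ for the expectation when $Y_0=x$. Fix $a>0$ and $f:\mathbb S\to\mathbb C$, and put $$\tau_a=\inf\Big\{t\ge 0:\ \sup_{0\le u\le t}Y_u-Y_t\ge a\Big\},\qquad T_A=\inf\{t>0:\ Y_t\notin A\}\quad(A\subseteq\mathbb R),$$ with $\inf\emptyset=\infty$. For $k,g:\mathbb S\to\mathbb C$, $A\subseteq\mathbb R$ and $x\in\mathbb S$ define $$B(k,x)=\mathbb E_x\Big[e^{-\int_0^{\tau_a}k(Y_s)\,ds}\,\mathbf 1_{\{\tau_a<\infty\}}\,f(Y_{\tau_a})\Big],\qquad P_A(k,x;g)=\mathbb E_x\Big[e^{-\int_0^{T_A}k(Y_s)\,ds}\,\mathbf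 1_{\{T_A<\infty\}}\,g(Y_{T_A})\Big].$$ Then for every $k:\mathbb S\to\mathbb C$ with $\Re k(z)\ge 0$ for all $z\in\mathbb S$ and every $x\in\mathbb S$, the random variables in the expectations $B(k,y)$, $y\in\mathbb S$, and $P_{(x-a,x]}(k,x;g)$, $g:\mathbb S\to\mathbb C$, are integrable, and $$B(k,x)=P_{(x-a,x]}\big(k,x;\,f(\cdot)\mathbf 1_{\{\cdot\le x-a\}}\big)+\sum_{y\in\mathbb S,\ y>x}P_{(x-a,x]}\big(k,x;\,\mathbf 1_{\{\cdot=y\}}\big)\,B(k,y).$$ -/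

import Mathlib

open MeasureTheory
open scoped NNReal ENNReal

namespace CTMC

noncomputable section

/-- Transition rate matrices on a finite set of real states: nonnegative off-diagonal entries and
`G(x,x) = -∑_{y ≠ x} G(x,y)`. -/
structure IsRateMatrix {S : Finset ℝ} (G : Matrix S S ℝ) : Prop where
  nonneg_of_ne : ∀ x y : S, x ≠ y → 0 ≤ G x y
  diag_eq : ∀ x : S, G x x = -∑ y ∈ Finset.univ.erase x, G x y

/-- `Y` is, under the family `(P x)` of probability measures, the continuous-time Markov chain with
rate matrix `G`, started from `x` under `P x`: its paths are right-continuous, and its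
finite-dimensional distributions are those given by the transition matrices `exp (t G)`. -/
structure IsMarkovChain {Ω : Type*} [MeasurableSpace Ω] {S : Finset ℝ} (G : Matrix S S ℝ)
    (P : S → Measure Ω) (Y : ℝ≥0 → Ω → S) : Prop where
  isProbabilityMeasure : ∀ x, IsProbabilityMeasure (P x)
  measurable : ∀ t, Measurable (Y t)
  rightContinuous : ∀ ω t, ContinuousWithinAt (fun s => Y s ω) (Set.Ici t) t
  finiteDimensional : ∀ (x : S) (n : ℕ) (t : Fin (n + 1) → ℝ≥0) (y : Fin (n + 1) → S),
    Monotone t → t 0 = 0 →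
      (P x).real {ω | ∀ i, Y (t i) ω = y i} =
        (if y 0 = x then 1 else 0) *
          ∏ i : Fin n,
            NormedSpace.exp (((t i.succ : ℝ) - (t i.castSucc : ℝ)) • G) (y i.castSucc) (y i.succ)

section Functionals

variable {Ω : Type*} {S : Finset ℝ}

/-- The first passage time `T_A = inf {t > 0 : Y_t ∉ A}`, which is `∞` if there is no such `t`. -/
def firstPassageTime (Y : ℝ≥0 → Ω → S) (A : Set ℝ) (ω : Ω) : ℝ≥0∞ :=
  ⨅ (t : ℝ≥0) (_ : 0 < t ∧ (Y t ω : ℝ) ∉ A), (t : ℝ≥0∞)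

/-- The running maximum `sup_{0 ≤ u ≤ t} Y_u`. -/
def runningMax (Y : ℝ≥0 → Ω → S) (t : ℝ≥0) (ω : Ω) : ℝ :=
  sSup ((fun u => (Y u ω : ℝ)) '' Set.Iic t)

/-- The drawdown time `τ_a = inf {t ≥ 0 : sup_{0 ≤ u ≤ t} Y_u - Y_t ≥ a}`, which is `∞` if there is
no such `t`. -/
def drawdownTime (Y : ℝ≥0 → Ω → S) (a : ℝ) (ω : Ω) : ℝ≥0∞ :=
  ⨅ (t : ℝ≥0) (_ : a ≤ runningMax Y t ω - (Y t ω : ℝ)), (t : ℝ≥0∞)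

/-- The random variable `exp (-∫_0^T k(Y_s) ds) 1_{T < ∞} f(Y_T)` for a random time `T`. -/
def discountedPayoff (Y : ℝ≥0 → Ω → S) (T : Ω → ℝ≥0∞) (k f : S → ℂ) (ω : Ω) : ℂ :=
  open Classical in
  if T ω < ∞ then
    Complex.exp (-∫ s in (0 : ℝ)..(T ω).toReal, k (Y s.toNNReal ω)) * f (Y (T ω).toNNReal ω)
  else 0

variable [MeasurableSpace Ω]

/-- `P_A(k, x; f) = E_x[exp (-∫_0^{T_A} k(Y_s) ds) 1_{T_A < ∞} f(Y_{T_A})]`. -/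
def passageValue (P : S → Measure Ω) (Y : ℝ≥0 → Ω → S) (A : Set ℝ) (k : S → ℂ) (x : S)
    (f : S → ℂ) : ℂ :=
  ∫ ω, discountedPayoff Y (firstPassageTime Y A) k f ω ∂(P x)

/-- `B(k, x) = E_x[exp (-∫_0^{τ_a} k(Y_s) ds) 1_{τ_a < ∞} f(Y_{τ_a})]`. -/
def drawdownValue (P : S → Measure Ω) (Y : ℝ≥0 → Ω → S) (a : ℝ) (f : S → ℂ) (k : S → ℂ)
    (x : S) : ℂ :=
  ∫ ω, discountedPayoff Y (drawdownTime Y a) k f ω ∂(P x)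

end Functionals

end

end CTMC

namespace CTMC

open Filter Topology

/-! Let `T` be the first exit from `(x - a, x]` of a path that starts at `x`. Before `T` any two
values differ by less than `a`, so `T ≤ τ_a`. If `T = ∞`, neither side contributes. If the path
leaves at or below `x - a`, the drawdown from its initial value `x` is already at least `a`, and
`τ_a = T`. If it leaves at some `y > x`, then `y` exceeds all earlier values, the running maximum
restarts at `y`, and `τ_a` is `T` plus the drawdown time of the path shifted by `T`; the discount
factor splits accordingly. This gives the pathwise identity `discountedPayoff_drawdownTime_eq`.
Taking expectations, the strong Markov property at `T` factors each term with `y > x`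
(`integral_passageEvent_mul`).

The past of a time is encoded by the stopped path and the future by the shifted path, so that
`strongMarkov` is a statement about product laws and expectations factor by Fubini. It is derived
from the finite-dimensional distributions alone: the product formula gives the Markov property at a
fixed time on cylinders, a π-system argument extends it to all events, and a countable decomposition
carries it to `T` rounded up to a grid. As the mesh tends to zero, right-continuity in a discrete
state space makes the cylinder events stabilize along each path. All this takes place on the
canonical path space, and the result is pulled back to `Ω` at the end. -/

/-- The space of right-continuous paths with values in a finite set of real states, with the
σ-algebra generated by the coordinates. -/
abbrev PathSpace (S : Finset ℝ) : Type :=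
  {w : ℝ≥0 → S // ∀ t, ContinuousWithinAt w (Set.Ici t) t}

namespace PathSpace

/-! ### Stopped and shifted paths, and measurability at random times. -/

variable {S : Finset ℝ}

/-- The coordinate process on the path space. -/
abbrev coord (t : ℝ≥0) (w : PathSpace S) : S := w.1 t

/-- The path stopped at time `s`. -/
def stopped (s : ℝ≥0) (w : PathSpace S) : PathSpace S :=
  ⟨fun t => w.1 (min t s), fun t => by
    refine ContinuousWithinAt.comp (t := Set.Ici (min t s)) (w.2 _)
      (by fun_prop : Continuous fun t : ℝ≥0 => min t s).continuousWithinAt ?_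
    intro u hu
    exact min_le_min_right s hu⟩

/-- The path shifted by time `s`. -/
def shift (s : ℝ≥0) (w : PathSpace S) : PathSpace S :=
  ⟨fun t => w.1 (s + t), fun t => by
    refine ContinuousWithinAt.comp (t := Set.Ici (s + t)) (w.2 _)
      (by fun_prop : Continuous fun t : ℝ≥0 => s + t).continuousWithinAt ?_
    intro u hu
    exact add_le_add_right (Set.mem_Ici.1 hu) s⟩

lemma stopped_apply (s : ℝ≥0) (w : PathSpace S) (t : ℝ≥0) : (stopped s w).1 t = w.1 (min t s) := rfl

lemma shift_apply (s : ℝ≥0) (w : PathSpace S) (t : ℝ≥0) : (shift s w).1 t = w.1 (s + t) := rfl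

/-- The finite state space is discrete, so right-continuity means being locally constant to the
right. -/
lemma eventually_eq (w : PathSpace S) (t : ℝ≥0) : ∀ᶠ s in 𝓝[≥] t, w.1 s = w.1 t := by
  have h := w.2 t
  rw [ContinuousWithinAt, nhds_discrete, tendsto_pure] at h
  exact h

lemma exists_lt_forall_eq (w : PathSpace S) (t : ℝ≥0) :
    ∃ r, t < r ∧ ∀ s, t ≤ s → s < r → w.1 s = w.1 t := by
  obtain ⟨r, hr, h⟩ := (mem_nhdsGE_iff_exists_Ico_subset' (lt_add_one t)).1 (eventually_eq w t)
  exact ⟨r, hr, fun s h1 h2 => h ⟨h1, h2⟩⟩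

lemma measurable_coord (t : ℝ≥0) : Measurable (coord (S := S) t) :=
  (measurable_pi_apply t).comp measurable_subtype_coe

/-- The smallest point of the grid of mesh `1 / (n + 1)` that lies strictly above `t`. -/
noncomputable def gridAbove (n : ℕ) (t : ℝ≥0) : ℝ≥0 := (⌊t * (n + 1)⌋₊ + 1 : ℕ) / (n + 1 : ℝ≥0)

lemma lt_gridAbove (n : ℕ) (t : ℝ≥0) : t < gridAbove n t := by
  rw [gridAbove, lt_div_iff₀ (by positivity)]
  exact_mod_cast Nat.lt_floor_add_one (t * (n + 1))

lemma gridAbove_le (n : ℕ) (t : ℝ≥0) : gridAbove n t ≤ t + 1 / (n + 1 : ℝ≥0) := by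
  rw [gridAbove, Nat.cast_add, Nat.cast_one, add_div]
  gcongr
  rw [div_le_iff₀ (by positivity)]
  exact Nat.floor_le (by positivity)

lemma tendsto_gridAbove (t : ℝ≥0) : Tendsto (fun n => gridAbove n t) atTop (𝓝[≥] t) := by
  refine tendsto_nhdsWithin_iff.2 ⟨?_, Eventually.of_forall fun n => (lt_gridAbove n t).le⟩
  have h : Tendsto (fun n : ℕ => t + 1 / (n + 1 : ℝ≥0)) atTop (𝓝 (t + 0)) :=
    tendsto_const_nhds.add (NNReal.tendsto_coe.1 (by
      simpa using tendsto_one_div_add_atTop_nhds_zero_nat (𝕜 := ℝ)))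
  rw [add_zero] at h
  exact tendsto_of_tendsto_of_tendsto_of_le_of_le tendsto_const_nhds h
    (fun n => (lt_gridAbove n t).le) (fun n => gridAbove_le n t)

lemma gridAbove_eq_iff (n j : ℕ) (t : ℝ≥0) :
    gridAbove n t = (j + 1 : ℕ) / (n + 1 : ℝ≥0) ↔
      (j : ℝ≥0) / (n + 1) ≤ t ∧ t < (j + 1 : ℕ) / (n + 1 : ℝ≥0) := by
  rw [gridAbove, div_left_inj' (by positivity), Nat.cast_inj, Nat.add_right_cancel_iff,
    Nat.floor_eq_iff (by positivity), div_le_iff₀ (by positivity), lt_div_iff₀ (by positivity)]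
  push_cast
  rfl

/-- Evaluation at the next grid point involves only countably many coordinates, and by
right-continuity it converges to evaluation at the time itself. -/
lemma measurable_uncurry_coord :
    Measurable fun p : ℝ≥0 × PathSpace S => p.2.1 p.1 := by
  refine measurable_of_tendsto_metrizable (f := fun n p => p.2.1 (gridAbove n p.1)) ?_ ?_
  · intro n
    have h : Measurable fun p : ℕ × PathSpace S => p.2.1 ((p.1 + 1 : ℕ) / (n + 1 : ℝ≥0)) :=
      measurable_from_prod_countable_right fun j =>
        measurable_coord ((j + 1 : ℕ) / (n + 1 : ℝ≥0))
    refine h.comp (Measurable.prodMk (?_ : Measurable fun p : ℝ≥0 × PathSpace S =>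
      ⌊p.1 * (n + 1)⌋₊) measurable_snd)
    exact Nat.measurable_floor.comp (measurable_fst.mul_const _)
  · refine tendsto_pi_nhds.2 fun p => ?_
    exact (p.2.2 p.1).tendsto.comp (tendsto_gridAbove p.1)

lemma measurable_coord_comp {α : Type*} [MeasurableSpace α] {T : α → ℝ≥0} {X : α → PathSpace S}
    (hT : Measurable T) (hX : Measurable X) : Measurable fun ω => (X ω).1 (T ω) :=
  measurable_uncurry_coord.comp (hT.prodMk hX)

lemma measurable_stopped {T : PathSpace S → ℝ≥0} (hT : Measurable T) :
    Measurable fun w => stopped (T w) w :=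
  Measurable.subtype_mk (measurable_pi_lambda _ fun _ =>
    measurable_coord_comp (measurable_const.min hT) measurable_id)

lemma measurable_shift {T : PathSpace S → ℝ≥0} (hT : Measurable T) :
    Measurable fun w => shift (T w) w :=
  Measurable.subtype_mk (measurable_pi_lambda _ fun _ =>
    measurable_coord_comp (hT.add_const _) measurable_id)

/-! ### First passage and drawdown times -/

lemma firstPassageTime_lt_iff {A : Set ℝ} {w : PathSpace S} {r : ℝ≥0∞} :
    firstPassageTime coord A w < r ↔ ∃ t : ℝ≥0, 0 < t ∧ (w.1 t : ℝ) ∉ A ∧ (t : ℝ≥0∞) < r := by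
  simp only [firstPassageTime, iInf_lt_iff, exists_prop, and_assoc]

/-- The running maximum is attained, because a path takes only finitely many values. -/
lemma le_runningMax_sub_iff {a : ℝ} {w : PathSpace S} {t : ℝ≥0} :
    a ≤ runningMax coord t w - (w.1 t : ℝ) ↔ ∃ u ≤ t, a ≤ (w.1 u : ℝ) - (w.1 t : ℝ) := by
  have hfin : ((fun u => (coord u w : ℝ)) '' Set.Iic t).Finite :=
    S.finite_toSet.subset (by rintro _ ⟨u, -, rfl⟩; exact (w.1 u).2)
  constructor
  · intro h
    obtain ⟨u, hu, hu'⟩ := Set.Nonempty.csSup_mem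
      (s := (fun u => (coord u w : ℝ)) '' Set.Iic t) ⟨_, t, le_refl t, rfl⟩ hfin
    refine ⟨u, hu, ?_⟩
    rw [runningMax, ← hu'] at h
    exact h
  · rintro ⟨u, hu, h⟩
    have : (w.1 u : ℝ) ≤ runningMax coord t w := le_csSup hfin.bddAbove ⟨u, hu, rfl⟩
    linarith

lemma drawdownTime_lt_iff {a : ℝ} {w : PathSpace S} {r : ℝ≥0∞} :
    drawdownTime coord a w < r ↔
      ∃ t u : ℝ≥0, u ≤ t ∧ a ≤ (w.1 u : ℝ) - (w.1 t : ℝ) ∧ (t : ℝ≥0∞) < r := by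
  simp only [drawdownTime, iInf_lt_iff, exists_prop]
  refine exists_congr fun t => ?_
  rw [show coord t w = w.1 t from rfl, le_runningMax_sub_iff]
  exact ⟨fun ⟨⟨u, h1, h2⟩, h3⟩ => ⟨u, h1, h2, h3⟩, fun ⟨u, h1, h2, h3⟩ => ⟨⟨u, h1, h2⟩, h3⟩⟩

/-- To the right of `t`, a dense set contains points at which the path has the value it has at
`t`, and these can be chosen below any given bound. -/
lemma exists_mem_dense_eq {D : Set ℝ≥0} (hD : Dense D) (w : PathSpace S) {t : ℝ≥0} {r : ℝ≥0∞}
    (htr : (t : ℝ≥0∞) < r) : ∃ q ∈ D, t < q ∧ (q : ℝ≥0∞) < r ∧ w.1 q = w.1 t := by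
  obtain ⟨s, hts, hs⟩ := exists_lt_forall_eq w t
  obtain ⟨r', hr', hr⟩ := ENNReal.lt_iff_exists_nnreal_btwn.1 htr
  obtain ⟨q, hq, h1, h2⟩ := hD.exists_between (lt_min hts (ENNReal.coe_lt_coe.1 hr'))
  exact ⟨q, hq, h1, (ENNReal.coe_lt_coe.2 (h2.trans_le (min_le_right _ _))).trans hr,
    hs q h1.le (h2.trans_le (min_le_left _ _))⟩

lemma measurableSet_coord_mem (t : ℝ≥0) (A : Set S) : MeasurableSet {w : PathSpace S | w.1 t ∈ A} :=
  measurable_coord t A.toFinite.measurableSet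

lemma measurable_firstPassageTime (A : Set ℝ) :
    Measurable (firstPassageTime (coord (S := S)) A) := by
  obtain ⟨D, hDc, hD⟩ := TopologicalSpace.exists_countable_dense ℝ≥0
  refine measurable_of_Iio fun r => ?_
  have : firstPassageTime (coord (S := S)) A ⁻¹' Set.Iio r =
      ⋃ q ∈ {q ∈ D | 0 < q ∧ (q : ℝ≥0∞) < r}, {w | w.1 q ∈ {z : S | (z : ℝ) ∉ A}} := by
    ext w
    simp only [Set.mem_preimage, Set.mem_Iio, firstPassageTime_lt_iff, Set.mem_iUnion, exists_prop,
      Set.mem_ofPred_eq]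
    constructor
    · rintro ⟨t, h0, hA, htr⟩
      obtain ⟨q, hq, h1, h2, h3⟩ := exists_mem_dense_eq hD w htr
      exact ⟨q, ⟨hq, h0.trans h1, h2⟩, by rwa [h3]⟩
    · rintro ⟨q, ⟨-, h1, h2⟩, h3⟩
      exact ⟨q, h1, h3, h2⟩
  rw [this]
  exact MeasurableSet.biUnion (hDc.mono fun _ h => h.1) fun q _ => measurableSet_coord_mem q _

lemma measurable_drawdownTime (a : ℝ) :
    Measurable (drawdownTime (coord (S := S)) a) := by
  obtain ⟨D, hDc, hD⟩ := TopologicalSpace.exists_countable_dense ℝ≥0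
  refine measurable_of_Iio fun r => ?_
  have : drawdownTime (coord (S := S)) a ⁻¹' Set.Iio r =
      ⋃ q ∈ {q ∈ D | (q : ℝ≥0∞) < r}, ⋃ p ∈ {p ∈ D | p ≤ q},
        {w | a ≤ (w.1 p : ℝ) - (w.1 q : ℝ)} := by
    ext w
    simp only [Set.mem_preimage, Set.mem_Iio, drawdownTime_lt_iff, Set.mem_iUnion, exists_prop,
      Set.mem_ofPred_eq]
    constructor
    · rintro ⟨t, u, hut, hau, htr⟩
      obtain ⟨q, hq, h1, h2, h3⟩ := exists_mem_dense_eq hD w htr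
      -- The strict inequality leaves room for a point of `D` between `u` and `q` at which the path
      -- still has its value at `u`.
      have hut' : u < q := hut.trans_lt h1
      obtain ⟨p, hp, h4, h5, h6⟩ := exists_mem_dense_eq hD w (ENNReal.coe_lt_coe.2 hut')
      exact ⟨q, ⟨hq, h2⟩, p, ⟨hp, (ENNReal.coe_lt_coe.1 h5).le⟩, by rwa [h3, h6]⟩
    · rintro ⟨q, ⟨-, h1⟩, p, ⟨-, h2⟩, h3⟩
      exact ⟨q, p, h2, h3, h1⟩
  rw [this]
  refine MeasurableSet.biUnion (hDc.mono fun _ h => h.1) fun q _ =>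
    MeasurableSet.biUnion (hDc.mono fun _ h => h.1) fun p _ => ?_
  exact measurableSet_le measurable_const ((measurable_subtype_coe.comp (measurable_coord p)).sub
    (measurable_subtype_coe.comp (measurable_coord q)))

/-! ### Discounted payoffs -/

lemma measurable_discount_integrand (k : S → ℂ) :
    Measurable fun p : PathSpace S × ℝ => k (p.1.1 p.2.toNNReal) :=
  (measurable_of_finite k).comp
    (measurable_coord_comp (measurable_real_toNNReal.comp measurable_snd) measurable_fst)

lemma intervalIntegrable_discount (k : S → ℂ) (w : PathSpace S) (b c : ℝ) :
    IntervalIntegrable (fun s : ℝ => k (w.1 s.toNNReal)) volume b c := by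
  obtain ⟨C, hC⟩ := (Set.finite_range fun z => ‖k z‖).bddAbove
  refine (intervalIntegrable_const (c := C)).mono_fun
    ((measurable_discount_integrand k).comp measurable_prodMk_left).aestronglyMeasurable
    (Eventually.of_forall fun s => ?_)
  exact (hC ⟨_, rfl⟩).trans (le_abs_self C)

lemma measurable_integral_discount (k : S → ℂ) {T : PathSpace S → ℝ≥0∞} (hT : Measurable T) :
    Measurable fun w => ∫ s in (0 : ℝ)..(T w).toReal, k (w.1 s.toNNReal) := by
  have h : ∀ w : PathSpace S, ∫ s in (0 : ℝ)..(T w).toReal, k (w.1 s.toNNReal) =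
      ∫ s, {p : PathSpace S × ℝ | 0 < p.2 ∧ p.2 ≤ (T p.1).toReal}.indicator
        (fun p => k (p.1.1 p.2.toNNReal)) (w, s) := by
    -- Moving the random endpoint into an indicator gives an integral over a fixed domain, whose
    -- measurability follows from joint measurability of the integrand.
    intro w
    rw [intervalIntegral.integral_of_le ENNReal.toReal_nonneg, ← integral_indicator measurableSet_Ioc]
    rfl
  simp_rw [h]
  refine (StronglyMeasurable.integral_prod_right' (Measurable.stronglyMeasurable ?_)).measurable
  refine (measurable_discount_integrand k).indicator ?_
  exact (measurableSet_lt measurable_const measurable_snd).inter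
    (measurableSet_le measurable_snd (hT.ennreal_toReal.comp measurable_fst))

lemma measurable_discountedPayoff (k f : S → ℂ) {T : PathSpace S → ℝ≥0∞} (hT : Measurable T) :
    Measurable (discountedPayoff coord T k f) := by
  classical
  unfold discountedPayoff
  refine Measurable.ite (measurableSet_lt hT measurable_const) ?_ measurable_const
  exact (Complex.measurable_exp.comp (measurable_integral_discount k hT).neg).mul
    ((measurable_of_finite f).comp (measurable_coord_comp hT.ennreal_toNNReal measurable_id))

lemma norm_exp_neg_integral_le_one {k : S → ℂ} (hk : ∀ z, 0 ≤ (k z).re) (w : PathSpace S)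
    {b : ℝ} (hb : 0 ≤ b) :
    ‖Complex.exp (-∫ s in (0 : ℝ)..b, k (w.1 s.toNNReal))‖ ≤ 1 := by
  rw [Complex.norm_exp, Real.exp_le_one_iff, Complex.neg_re, neg_nonpos]
  have h := Complex.reCLM.intervalIntegral_comp_comm (intervalIntegrable_discount k w 0 b)
  simp only [Complex.reCLM_apply] at h
  rw [← h]
  exact intervalIntegral.integral_nonneg hb fun s _ => hk _

lemma integrable_discountedPayoff {k : S → ℂ} (hk : ∀ z, 0 ≤ (k z).re) (f : S → ℂ)
    {T : PathSpace S → ℝ≥0∞} (hT : Measurable T) (μ : Measure (PathSpace S)) [IsFiniteMeasure μ] :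
    Integrable (discountedPayoff coord T k f) μ := by
  obtain ⟨C, hC⟩ := (Set.finite_range fun z => ‖f z‖).bddAbove
  -- The maximum with `0` also bounds the value `0` taken where `T = ∞`.
  refine Integrable.of_bound (measurable_discountedPayoff k f hT).aestronglyMeasurable (max C 0)
    (Eventually.of_forall fun w => ?_)
  rw [discountedPayoff]
  split_ifs
  · rw [norm_mul]
    calc _ ≤ 1 * ‖f (coord (T w).toNNReal w)‖ := by
          gcongr
          exact norm_exp_neg_integral_le_one hk w ENNReal.toReal_nonneg
      _ ≤ _ := by rw [one_mul]; exact (hC ⟨_, rfl⟩).trans (le_max_left _ _)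
  · simp

/-! ### Cylinders and product laws. -/

/-- The set of paths that agree with `v` at the times in `I`. -/
def cylinder (I : Finset ℝ≥0) (v : ℝ≥0 → S) : Set (PathSpace S) := {w | ∀ t ∈ I, w.1 t = v t}

lemma mem_cylinder {I : Finset ℝ≥0} {v : ℝ≥0 → S} {w : PathSpace S} :
    w ∈ cylinder I v ↔ ∀ t ∈ I, w.1 t = v t := Iff.rfl

lemma measurableSet_cylinder (I : Finset ℝ≥0) (v : ℝ≥0 → S) : MeasurableSet (cylinder I v) := by
  have : cylinder I v = ⋂ t ∈ I, {w | w.1 t ∈ ({v t} : Set S)} := by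
    ext w; simp [mem_cylinder]
  rw [this]
  exact I.measurableSet_biInter fun t _ => measurableSet_coord_mem t _

/-- The collection of all cylinders. -/
def cylinders (S : Finset ℝ) : Set (Set (PathSpace S)) :=
  {C | ∃ (I : Finset ℝ≥0) (v : ℝ≥0 → S), C = cylinder I v}

/-- Any path in a nonempty intersection of two cylinders prescribes the values on the union of their
time sets. -/
lemma isPiSystem_cylinders : IsPiSystem (cylinders S) := by
  classical
  rintro _ ⟨I, v, rfl⟩ _ ⟨J, u, rfl⟩ ⟨w, hwI, hwJ⟩
  refine ⟨I ∪ J, w.1, ?_⟩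
  ext w'
  simp only [Set.mem_inter_iff, mem_cylinder, Finset.mem_union] at *
  constructor
  · rintro ⟨h1, h2⟩ t (ht | ht)
    · rw [h1 t ht, hwI t ht]
    · rw [h2 t ht, hwJ t ht]
  · intro h
    exact ⟨fun t ht => by rw [h t (Or.inl ht), hwI t ht],
      fun t ht => by rw [h t (Or.inr ht), hwJ t ht]⟩

lemma generateFrom_cylinders :
    MeasurableSpace.generateFrom (cylinders S) = (inferInstance : MeasurableSpace (PathSpace S)) := by
  refine le_antisymm (MeasurableSpace.generateFrom_le ?_) ?_
  · rintro _ ⟨I, v, rfl⟩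
    exact measurableSet_cylinder I v
  · have h : @Measurable (PathSpace S) (ℝ≥0 → S) (MeasurableSpace.generateFrom (cylinders S)) _
        Subtype.val := by
      refine @measurable_pi_lambda _ _ _ (MeasurableSpace.generateFrom (cylinders S)) _ _ fun t => ?_
      refine @measurable_to_countable' _ _ _ _ (MeasurableSpace.generateFrom (cylinders S)) _ ?_
      intro z
      refine MeasurableSpace.measurableSet_generateFrom ⟨{t}, fun _ => z, ?_⟩
      ext w
      simp [mem_cylinder]
    exact h.comap_le

/-- Two path-valued maps have, on the event `E`, a product law as soon as they do so on
cylinders. -/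
lemma map_prodMk_restrict_eq_prod {μ ν : Measure (PathSpace S)} [IsFiniteMeasure μ]
    [IsFiniteMeasure ν] (v : ℝ≥0 → S) {X Z : PathSpace S → PathSpace S}
    (hX : Measurable X) (hZ : Measurable Z)
    {E : Set (PathSpace S)}
    (h : ∀ (I J : Finset ℝ≥0) (v u : ℝ≥0 → S),
      μ (E ∩ X ⁻¹' cylinder I v ∩ Z ⁻¹' cylinder J u) =
        μ (E ∩ X ⁻¹' cylinder I v) * ν (cylinder J u)) :
    (μ.restrict E).map (fun w => (X w, Z w)) = ((μ.restrict E).map X).prod ν := by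
  -- The whole space is the cylinder over no times; writing it so still takes some function into
  -- `S`, which `v` provides.
  have huniv : Set.univ ∈ cylinders S := ⟨∅, v, by ext; simp [mem_cylinder]⟩
  have span : ∀ ρ : Measure (PathSpace S), IsFiniteMeasure ρ →
      Nonempty (ρ.FiniteSpanningSetsIn (cylinders S)) := fun ρ _ =>
    ⟨⟨fun _ => Set.univ, fun _ => huniv, fun _ => measure_lt_top _ _, Set.iUnion_const _⟩⟩
  refine (Measure.prod_eq_generateFrom generateFrom_cylinders generateFrom_cylinders
    isPiSystem_cylinders isPiSystem_cylinders (span _ inferInstance).some (span _ inferInstance).some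
    ?_).symm
  rintro _ ⟨I, v, rfl⟩ _ ⟨J, u, rfl⟩
  have hI := hX (measurableSet_cylinder I v)
  have hJ := hZ (measurableSet_cylinder J u)
  rw [Measure.map_apply (hX.prodMk hZ)
      ((measurableSet_cylinder I v).prod (measurableSet_cylinder J u)),
    Measure.map_apply hX (measurableSet_cylinder I v), Measure.restrict_apply hI,
    Set.mk_preimage_prod, Measure.restrict_apply (hI.inter hJ), Set.inter_comm _ E,
    ← Set.inter_assoc, h, Set.inter_comm E]

/-! ### Finite-dimensional distributions -/

variable {G : Matrix S S ℝ} {Q : S → Measure (PathSpace S)}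

/-- The probability that the chain passes through the states `y 1, …, y n` at the times
`t 1, …, t n`, given that it is in `y 0` at time `t 0`. -/
noncomputable def transitionProd (G : Matrix S S ℝ) (n : ℕ) (t : ℕ → ℝ≥0) (y : ℕ → S) : ℝ :=
  ∏ i ∈ Finset.range n, NormedSpace.exp (((t (i + 1) : ℝ) - (t i : ℝ)) • G) (y i) (y (i + 1))

lemma measureReal_forall_le (hQ : IsMarkovChain G Q coord) (x : S) (n : ℕ) {t : ℕ → ℝ≥0}
    (ht : Monotone t) (h0 : t 0 = 0) {y : ℕ → S} (hy : y 0 = x) :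
    (Q x).real {w | ∀ i ≤ n, w.1 (t i) = y i} = transitionProd G n t y := by
  have h := hQ.finiteDimensional x n (fun i => t i) (fun i => y i)
    (fun i j hij => ht hij) h0
  have hset : {w : PathSpace S | ∀ i : Fin (n + 1), coord (t i) w = y i} =
      {w | ∀ i ≤ n, w.1 (t i) = y i} := by
    ext w
    exact ⟨fun h i hi => h ⟨i, by omega⟩, fun h i => h i (by omega)⟩
  rw [hset] at h
  rw [h, transitionProd, Finset.prod_range]
  simp [hy]

/-- The increasing enumeration of a finite set of times, which stays at the maximum after the last
element. -/
lemma exists_monotone_enumeration (I : Finset ℝ≥0) {s : ℝ≥0} (h0 : 0 ∈ I) (hs : s ∈ I)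
    (hle : ∀ u ∈ I, u ≤ s) :
    ∃ (n : ℕ) (t : ℕ → ℝ≥0), Monotone t ∧ t 0 = 0 ∧ t n = s ∧ (∀ i, t i ∈ I) ∧
      ∀ u ∈ I, ∃ i ≤ n, t i = u := by
  obtain ⟨n, hn⟩ : ∃ n, I.card = n + 1 :=
    ⟨I.card - 1, by have := Finset.card_pos.2 ⟨0, h0⟩; omega⟩
  let e := I.orderEmbOfFin hn
  let t : ℕ → ℝ≥0 := fun i => e ⟨min i n, by omega⟩
  have hmono : Monotone t := fun i j hij => e.monotone (by
    simp only [Fin.mk_le_mk]; exact min_le_min_right n hij)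
  have hmem : ∀ i, t i ∈ I := fun i => I.orderEmbOfFin_mem hn _
  have hsurj : ∀ u ∈ I, ∃ i ≤ n, t i = u := by
    intro u hu
    have : u ∈ Set.range e := by rw [I.range_orderEmbOfFin hn]; exact hu
    obtain ⟨i, hi⟩ := this
    refine ⟨i, by omega, ?_⟩
    rw [← hi]
    exact congrArg e (Fin.ext (min_eq_left (by omega)))
  refine ⟨n, t, hmono, ?_, ?_, hmem, hsurj⟩
  · obtain ⟨i, -, hi⟩ := hsurj 0 h0
    exact le_antisymm (hi ▸ hmono (Nat.zero_le i)) zero_le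
  · obtain ⟨i, hin, hi⟩ := hsurj s hs
    exact le_antisymm (hle _ (hmem n)) (hi ▸ hmono hin)

lemma cylinder_eq_forall_le {I : Finset ℝ≥0} {n : ℕ} {t : ℕ → ℝ≥0} (hmem : ∀ i, t i ∈ I)
    (hsurj : ∀ u ∈ I, ∃ i ≤ n, t i = u) (v : ℝ≥0 → S) :
    cylinder I v = {w | ∀ i ≤ n, w.1 (t i) = v (t i)} := by
  ext w
  refine ⟨fun h i _ => h _ (hmem i), fun h u hu => ?_⟩
  obtain ⟨i, hi, rfl⟩ := hsurj u hu
  exact h i hi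

/-- The Markov property at the time `s` for cylinders that contain the times `0` and `s`. -/
lemma measureReal_cylinder_inter_shift (hQ : IsMarkovChain G Q coord) {x y : S} {s : ℝ≥0}
    {I J : Finset ℝ≥0} {v u : ℝ≥0 → S} (hI0 : 0 ∈ I) (hIs : s ∈ I) (hI : ∀ r ∈ I, r ≤ s)
    (hJ0 : 0 ∈ J) (hv0 : v 0 = x) (hvs : v s = y) (hu0 : u 0 = y) :
    (Q x).real (cylinder I v ∩ shift s ⁻¹' cylinder J u) =
      (Q x).real (cylinder I v) * (Q y).real (cylinder J u) := by
  obtain ⟨n, t, htm, ht0, htn, htmem, htsurj⟩ := exists_monotone_enumeration I hI0 hIs hI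
  obtain ⟨m, r, hrm, hr0, -, hrmem, hrsurj⟩ := exists_monotone_enumeration J hJ0
    (J.max'_mem ⟨0, hJ0⟩) (fun _ h => J.le_max' _ h)
  -- The two time grids are concatenated at index `n`, where both descriptions agree: `t n = s = s +
  -- r 0` and `v s = y = u 0`.
  let t' : ℕ → ℝ≥0 := fun i => if i ≤ n then t i else s + r (i - n)
  let y' : ℕ → S := fun i => if i ≤ n then v (t i) else u (r (i - n))
  have ht'l : ∀ i ≤ n, t' i = t i := fun i hi => if_pos hi
  have ht'r : ∀ j, t' (n + j) = s + r j := fun j => by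
    rcases Nat.eq_zero_or_pos j with rfl | hj
    · rw [add_zero, ht'l n le_rfl, htn, hr0, add_zero]
    · simp only [t', if_neg (show ¬ n + j ≤ n by omega), Nat.add_sub_cancel_left]
  have hy'l : ∀ i ≤ n, y' i = v (t i) := fun i hi => if_pos hi
  have hy'r : ∀ j, y' (n + j) = u (r j) := fun j => by
    rcases Nat.eq_zero_or_pos j with rfl | hj
    · rw [add_zero, hy'l n le_rfl, htn, hr0, hvs, hu0]
    · simp only [y', if_neg (show ¬ n + j ≤ n by omega), Nat.add_sub_cancel_left]
  have ht'm : Monotone t' := by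
    refine monotone_nat_of_le_succ fun i => ?_
    rcases lt_or_ge i n with hi | hi
    · rw [ht'l i hi.le, ht'l (i + 1) hi]
      exact htm (Nat.le_succ i)
    · obtain ⟨j, rfl⟩ := Nat.exists_eq_add_of_le hi
      rw [add_assoc, ht'r, ht'r]
      exact add_le_add_right (hrm (Nat.le_succ j)) s
  have hset : cylinder I v ∩ shift s ⁻¹' cylinder J u = {w | ∀ i ≤ n + m, w.1 (t' i) = y' i} := by
    rw [cylinder_eq_forall_le htmem htsurj v, cylinder_eq_forall_le hrmem hrsurj u]
    ext w
    constructor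
    · rintro ⟨h1, h2⟩ i hi
      rcases le_total i n with hin | hin
      · rw [ht'l i hin, hy'l i hin]
        exact h1 i hin
      · obtain ⟨j, rfl⟩ := Nat.exists_eq_add_of_le hin
        rw [ht'r, hy'r]
        exact h2 j (by omega)
    · intro h
      refine ⟨fun i hi => ?_, fun j hj => ?_⟩
      · have := h i (by omega)
        rwa [ht'l i hi, hy'l i hi] at this
      · have := h (n + j) (by omega)
        rwa [ht'r, hy'r] at this
  rw [hset, measureReal_forall_le hQ x (n + m) ht'm (by rw [ht'l 0 (Nat.zero_le n), ht0])
      (by rw [hy'l 0 (Nat.zero_le n), ht0, hv0]),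
    cylinder_eq_forall_le htmem htsurj v, cylinder_eq_forall_le hrmem hrsurj u,
    measureReal_forall_le hQ x n htm ht0 (y := fun i => v (t i)) (by simp only [ht0, hv0]),
    measureReal_forall_le hQ y m hrm hr0 (y := fun i => u (r i)) (by simp only [hr0, hu0]),
    transitionProd, transitionProd, transitionProd, Finset.prod_range_add]
  congr 1
  · refine Finset.prod_congr rfl fun i hi => ?_
    have hi' := Finset.mem_range.1 hi
    rw [ht'l i hi'.le, ht'l (i + 1) hi', hy'l i hi'.le, hy'l (i + 1) hi']
  · refine Finset.prod_congr rfl fun j _ => ?_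
    rw [add_assoc, ht'r, ht'r, hy'r, hy'r, NNReal.coe_add, NNReal.coe_add, add_sub_add_left_eq_sub]

lemma ae_coord_zero (hQ : IsMarkovChain G Q coord) (x : S) : ∀ᵐ w ∂(Q x), w.1 0 = x := by
  have := hQ.isProbabilityMeasure x
  have h := measureReal_forall_le hQ x 0 (t := fun _ => 0) monotone_const rfl (y := fun _ => x) rfl
  have hset : {w : PathSpace S | ∀ i ≤ 0, w.1 ((fun _ : ℕ => (0 : ℝ≥0)) i) = (fun _ : ℕ => x) i} =
      {w | w.1 0 ∈ ({x} : Set S)} := by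
    ext w; simp
  rw [hset, transitionProd, Finset.prod_range_zero] at h
  have h1 : (Q x) {w | w.1 0 ∈ ({x} : Set S)} = 1 := by
    rw [← ofReal_measureReal (measure_ne_top _ _), h, ENNReal.ofReal_one]
  exact (prob_compl_eq_zero_iff (measurableSet_coord_mem 0 {x})).2 h1

/-! ### The Markov property at a fixed time -/

/-- Adding the almost sure events that the chain starts in its initial state turns both events into
cylinders that contain the times required by `measureReal_cylinder_inter_shift`. -/
lemma measure_stopped_inter_shift_cylinder (hQ : IsMarkovChain G Q coord) (x y : S) (s : ℝ≥0)
    (I J : Finset ℝ≥0) (v u : ℝ≥0 → S) :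
    (Q x) ({w | w.1 s = y} ∩ stopped s ⁻¹' cylinder I v ∩ shift s ⁻¹' cylinder J u) =
      (Q x) ({w | w.1 s = y} ∩ stopped s ⁻¹' cylinder I v) * (Q y) (cylinder J u) := by
  classical
  have := hQ.isProbabilityMeasure
  set E : Set (PathSpace S) := {w | w.1 0 = x} ∩ ({w | w.1 s = y} ∩ stopped s ⁻¹' cylinder I v) with hE
  set F : Set (PathSpace S) := {w | w.1 0 = y} ∩ cylinder J u with hF
  have h1 : (Q x) ({w | w.1 s = y} ∩ stopped s ⁻¹' cylinder I v ∩ shift s ⁻¹' cylinder J u) =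
      (Q x) (E ∩ shift s ⁻¹' F) := by
    refine measure_congr ?_
    filter_upwards [ae_coord_zero hQ x] with w hw
    refine propext ⟨fun h => ⟨⟨hw, h.1⟩, ?_, h.2⟩, fun h => ⟨h.1.2, h.2.2⟩⟩
    have : w.1 s = y := h.1.1
    simpa [shift_apply] using this
  have h2 : (Q x) ({w | w.1 s = y} ∩ stopped s ⁻¹' cylinder I v) = (Q x) E := by
    refine measure_congr ?_
    filter_upwards [ae_coord_zero hQ x] with w hw
    exact propext ⟨fun h => ⟨hw, h⟩, fun h => h.2⟩
  have h3 : (Q y) (cylinder J u) = (Q y) F := by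
    refine measure_congr ?_
    filter_upwards [ae_coord_zero hQ y] with w hw
    exact propext ⟨fun h => ⟨hw, h⟩, fun h => h.2⟩
  rw [h1, h2, h3]
  -- A member of `E` or `F` serves as the function that prescribes the values of the corresponding
  -- cylinder; empty sets are trivial.
  rcases E.eq_empty_or_nonempty with hE0 | ⟨w₁, hw₁⟩
  · simp [hE0]
  rcases F.eq_empty_or_nonempty with hF0 | ⟨w₂, hw₂⟩
  · simp [hF0]
  have hE' : E = cylinder (insert 0 (insert s (I.image fun t => min t s))) w₁.1 := by
    obtain ⟨a1, a2, a3⟩ := hw₁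
    ext w
    simp only [mem_cylinder, Finset.forall_mem_insert, Finset.forall_mem_image, hE]
    constructor
    · rintro ⟨b1, b2, b3⟩
      exact ⟨Eq.trans b1 (Eq.symm a1), Eq.trans b2 (Eq.symm a2),
        fun t ht => Eq.trans (b3 t ht) (a3 t ht).symm⟩
    · rintro ⟨b1, b2, b3⟩
      exact ⟨Eq.trans b1 a1, Eq.trans b2 a2, fun t ht => Eq.trans (b3 ht) (a3 t ht)⟩
  have hF' : F = cylinder (insert 0 J) w₂.1 := by
    obtain ⟨a1, a2⟩ := hw₂
    ext w
    simp only [mem_cylinder, Finset.forall_mem_insert, hF]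
    constructor
    · rintro ⟨b1, b2⟩
      exact ⟨Eq.trans b1 (Eq.symm a1), fun t ht => Eq.trans (b2 t ht) (a2 t ht).symm⟩
    · rintro ⟨b1, b2⟩
      exact ⟨Eq.trans b1 a1, fun t ht => Eq.trans (b2 t ht) (a2 t ht)⟩
  have key := measureReal_cylinder_inter_shift hQ (x := x) (y := y) (s := s)
    (I := insert 0 (insert s (I.image fun t => min t s))) (J := insert 0 J) (v := w₁.1) (u := w₂.1)
    (by simp) (by simp) (by simp) (by simp) hw₁.1 hw₁.2.1 hw₂.1
  rw [← hE', ← hF', measureReal_def, measureReal_def, measureReal_def, ← ENNReal.toReal_mul] at key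
  exact (ENNReal.toReal_eq_toReal_iff' (measure_ne_top _ _)
    (ENNReal.mul_ne_top (measure_ne_top _ _) (measure_ne_top _ _))).1 key

/-- The Markov property: on `{w s = y}`, the path shifted by `s` is independent of the path stopped
at `s` and has the law of the chain started from `y`. -/
lemma measure_inter_stopped_inter_shift (hQ : IsMarkovChain G Q coord) (x y : S) (s : ℝ≥0)
    {C D : Set (PathSpace S)} (hC : MeasurableSet C) (hD : MeasurableSet D) :
    (Q x) ({w | w.1 s = y} ∩ stopped s ⁻¹' C ∩ shift s ⁻¹' D) =
      (Q x) ({w | w.1 s = y} ∩ stopped s ⁻¹' C) * (Q y) D := by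
  have := hQ.isProbabilityMeasure
  have hst := measurable_stopped (S := S) (measurable_const (a := s))
  have hsh := measurable_shift (S := S) (measurable_const (a := s))
  have h := map_prodMk_restrict_eq_prod (μ := Q x) (ν := Q y) (fun _ => x) hst hsh
    (measure_stopped_inter_shift_cylinder hQ x y s)
  have h' := congrArg (fun μ => μ (C ×ˢ D)) h
  simp only [Measure.prod_prod] at h'
  rw [Measure.map_apply (hst.prodMk hsh) (hC.prod hD), Measure.map_apply hst hC,
    Measure.restrict_apply (hst hC), Set.mk_preimage_prod,
    Measure.restrict_apply ((hst hC).inter (hsh hD))] at h'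
  rw [Set.inter_assoc, Set.inter_comm _ (stopped s ⁻¹' C ∩ _), Set.inter_comm _ (stopped s ⁻¹' C)]
  exact h'

/-! ### The strong Markov property at first passage times -/

/-- Whether the exit happens strictly before `r` is decided by the path before `r`. The strict
inequality matters: an exit by time `r` inclusive could depend on the path just after `r`. -/
lemma firstPassageTime_stopped_lt_iff (A : Set ℝ) (w : PathSpace S) {r s : ℝ≥0} (hrs : r ≤ s) :
    firstPassageTime coord A (stopped s w) < r ↔ firstPassageTime coord A w < r := by
  simp only [firstPassageTime_lt_iff, ENNReal.coe_lt_coe, stopped_apply]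
  refine exists_congr fun t => and_congr_right fun _ => ?_
  rw [and_comm, and_comm (a := (w.1 t : ℝ) ∉ A)]
  refine and_congr_right fun h => ?_
  rw [min_eq_left (h.le.trans hrs)]

/-- The Markov property at the discretized first passage time. -/
lemma measure_gridAbove_inter_stopped_inter_shift (hQ : IsMarkovChain G Q coord) (A : Set ℝ) (x y : S)
    (n : ℕ) {C D : Set (PathSpace S)} (hC : MeasurableSet C) (hD : MeasurableSet D) :
    let σ := fun w : PathSpace S => gridAbove n (firstPassageTime coord A w).toNNReal
    (Q x) {w | (firstPassageTime coord A w < ∞ ∧ w.1 (σ w) = y ∧ stopped (σ w) w ∈ C) ∧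
        shift (σ w) w ∈ D} =
      (Q x) {w | firstPassageTime coord A w < ∞ ∧ w.1 (σ w) = y ∧ stopped (σ w) w ∈ C} * (Q y) D := by
  intro σ
  set s : ℕ → ℝ≥0 := fun j => (j + 1 : ℕ) / (n + 1 : ℝ≥0) with hs
  -- `B j` says that the passage time lies in the grid cell `[j / (n + 1), (j + 1) / (n + 1))`,
  -- which is where its discretization equals `s j`. Phrased by strict inequalities, it is
  -- determined by the path stopped at `s j`.
  set B : ℕ → Set (PathSpace S) := fun j =>
    {w | ¬ firstPassageTime coord A w < ((j : ℝ≥0) / (n + 1) : ℝ≥0) ∧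
      firstPassageTime coord A w < s j} with hB
  have hBm : ∀ j, MeasurableSet (B j) := fun j =>
    (measurableSet_lt (measurable_firstPassageTime A) measurable_const).compl.inter
      (measurableSet_lt (measurable_firstPassageTime A) measurable_const)
  have hBstop : ∀ j w, stopped (s j) w ∈ B j ↔ w ∈ B j := by
    intro j w
    refine and_congr (not_congr (firstPassageTime_stopped_lt_iff A w ?_))
      (firstPassageTime_stopped_lt_iff A w le_rfl)
    simp only [hs]
    gcongr
    exact Nat.le_succ j
  have hBσ : ∀ j w, w ∈ B j ↔ firstPassageTime coord A w < ∞ ∧ σ w = s j := by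
    intro j w
    have hlt : firstPassageTime coord A w < s j → firstPassageTime coord A w < ∞ :=
      fun h => h.trans ENNReal.coe_lt_top
    rw [← and_iff_right_of_imp (fun h : w ∈ B j => hlt h.2)]
    refine and_congr_right fun hfin => ?_
    obtain ⟨T, hT⟩ := WithTop.ne_top_iff_exists.1 hfin.ne
    replace hT : firstPassageTime coord A w = (T : ℝ≥0∞) := hT.symm
    simp only [σ, hs, gridAbove_eq_iff, hB, Set.mem_ofPred_eq, hT, ENNReal.coe_lt_coe,
      ENNReal.toNNReal_coe, ENNReal.coe_le_coe, not_lt]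
  have hdisj : Pairwise (Function.onFun Disjoint B) := by
    intro i j hij
    rw [Function.onFun, Set.disjoint_left]
    intro w hi hj
    have h := ((hBσ i w).1 hi).2.symm.trans ((hBσ j w).1 hj).2
    simp only [hs] at h
    rw [div_left_inj' (by positivity), Nat.cast_inj] at h
    omega
  have hex : ∀ w, firstPassageTime coord A w < ∞ → ∃ j, w ∈ B j := fun w h => by
    refine ⟨⌊(firstPassageTime coord A w).toNNReal * (n + 1)⌋₊, (hBσ _ w).2 ⟨h, rfl⟩⟩
  have hset₁ : {w | (firstPassageTime coord A w < ∞ ∧ w.1 (σ w) = y ∧ stopped (σ w) w ∈ C) ∧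
        shift (σ w) w ∈ D} =
      ⋃ j, {w | w.1 (s j) = y} ∩ stopped (s j) ⁻¹' (B j ∩ C) ∩ shift (s j) ⁻¹' D := by
    ext w
    simp only [Set.mem_iUnion, Set.mem_inter_iff, Set.mem_preimage, Set.mem_ofPred_eq, hBstop]
    constructor
    · rintro ⟨⟨h1, h2, h3⟩, h4⟩
      obtain ⟨j, hj⟩ := hex w h1
      have hσ := ((hBσ j w).1 hj).2
      rw [hσ] at h2 h3 h4
      exact ⟨j, ⟨h2, hj, h3⟩, h4⟩
    · rintro ⟨j, ⟨h2, hj, h3⟩, h4⟩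
      obtain ⟨h1, hσ⟩ := (hBσ j w).1 hj
      rw [hσ]
      exact ⟨⟨h1, h2, h3⟩, h4⟩
  have hset₂ : {w | firstPassageTime coord A w < ∞ ∧ w.1 (σ w) = y ∧ stopped (σ w) w ∈ C} =
      ⋃ j, {w | w.1 (s j) = y} ∩ stopped (s j) ⁻¹' (B j ∩ C) := by
    ext w
    simp only [Set.mem_iUnion, Set.mem_inter_iff, Set.mem_preimage, Set.mem_ofPred_eq, hBstop]
    constructor
    · rintro ⟨h1, h2, h3⟩
      obtain ⟨j, hj⟩ := hex w h1
      have hσ := ((hBσ j w).1 hj).2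
      rw [hσ] at h2 h3
      exact ⟨j, h2, hj, h3⟩
    · rintro ⟨j, h2, hj, h3⟩
      obtain ⟨h1, hσ⟩ := (hBσ j w).1 hj
      rw [hσ]
      exact ⟨h1, h2, h3⟩
  have hm : ∀ j, MeasurableSet ({w : PathSpace S | w.1 (s j) = y} ∩ stopped (s j) ⁻¹' (B j ∩ C)) :=
    fun j => (measurableSet_coord_mem (s j) {y}).inter
      (measurable_stopped measurable_const ((hBm j).inter hC))
  have hsub : ∀ j, {w : PathSpace S | w.1 (s j) = y} ∩ stopped (s j) ⁻¹' (B j ∩ C) ⊆ B j :=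
    fun j w hw => (hBstop j w).1 hw.2.1
  rw [hset₁, hset₂, measure_iUnion, measure_iUnion, ← ENNReal.tsum_mul_right]
  · exact tsum_congr fun j => measure_inter_stopped_inter_shift hQ x y (s j) ((hBm j).inter hC) hD
  · exact fun i j hij => (hdisj hij).mono (hsub i) (hsub j)
  · exact hm
  · exact fun i j hij => (hdisj hij).mono (Set.inter_subset_left.trans (hsub i))
      (Set.inter_subset_left.trans (hsub j))
  · exact fun j => (hm j).inter (measurable_shift measurable_const hD)

lemma eventually_coord_eq {w : PathSpace S} {t : ℝ≥0} {u : ℕ → ℝ≥0}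
    (hu : Tendsto u atTop (𝓝[≥] t)) : ∀ᶠ n in atTop, w.1 (u n) = w.1 t :=
  hu (eventually_eq w t)

/-- A cylinder involves finitely many times, and at each of them the approximation from the right is
eventually exact. This is why the limit in `strongMarkov` is taken on cylinders. -/
lemma eventually_stopped_mem_cylinder_iff (I : Finset ℝ≥0) (v : ℝ≥0 → S) (w : PathSpace S) {T : ℝ≥0}
    {u : ℕ → ℝ≥0} (hu : Tendsto u atTop (𝓝[≥] T)) :
    ∀ᶠ n in atTop, stopped (u n) w ∈ cylinder I v ↔ stopped T w ∈ cylinder I v := by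
  have h : ∀ᶠ n in atTop, ∀ t ∈ I, w.1 (min t (u n)) = w.1 (min t T) := by
    refine (Filter.eventually_all_finset I).2 fun t _ => eventually_coord_eq ?_
    obtain ⟨h1, h2⟩ := tendsto_nhdsWithin_iff.1 hu
    exact tendsto_nhdsWithin_iff.2 ⟨tendsto_const_nhds.min h1,
      h2.mono fun n hn => min_le_min_left t hn⟩
  filter_upwards [h] with n hn
  simp only [mem_cylinder, stopped_apply]
  exact forall₂_congr fun t ht => by rw [hn t ht]

lemma eventually_shift_mem_cylinder_iff (J : Finset ℝ≥0) (v : ℝ≥0 → S) (w : PathSpace S) {T : ℝ≥0}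
    {u : ℕ → ℝ≥0} (hu : Tendsto u atTop (𝓝[≥] T)) :
    ∀ᶠ n in atTop, shift (u n) w ∈ cylinder J v ↔ shift T w ∈ cylinder J v := by
  have h : ∀ᶠ n in atTop, ∀ t ∈ J, w.1 (u n + t) = w.1 (T + t) := by
    refine (Filter.eventually_all_finset J).2 fun t _ => eventually_coord_eq ?_
    obtain ⟨h1, h2⟩ := tendsto_nhdsWithin_iff.1 hu
    exact tendsto_nhdsWithin_iff.2 ⟨h1.add_const t, h2.mono fun n hn => add_le_add_left hn t⟩
  filter_upwards [h] with n hn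
  simp only [mem_cylinder, shift_apply]
  exact forall₂_congr fun t ht => by rw [hn t ht]

/-- The strong Markov property: on `{T < ∞, w T = y}`, where `T` is a first passage time, the path
shifted by `T` is independent of the path stopped at `T` and has the law of the chain started from
`y`. -/
lemma strongMarkov (hQ : IsMarkovChain G Q coord) (A : Set ℝ) (x y : S) :
    let T := fun w : PathSpace S => (firstPassageTime coord A w).toNNReal
    let E := {w : PathSpace S | firstPassageTime coord A w < ∞ ∧ w.1 (T w) = y}
    ((Q x).restrict E).map (fun w => (stopped (T w) w, shift (T w) w)) =
      (((Q x).restrict E).map fun w => stopped (T w) w).prod (Q y) := by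
  intro T E
  have := hQ.isProbabilityMeasure
  have hT : Measurable T := (measurable_firstPassageTime A).ennreal_toNNReal
  have hgrid : ∀ n, Measurable fun w => gridAbove n (T w) := fun n => by
    have h1 : Measurable fun w => ⌊T w * (n + 1)⌋₊ := Nat.measurable_floor.comp (hT.mul_const _)
    exact (measurable_of_countable fun j : ℕ => (j + 1 : ℕ) / (n + 1 : ℝ≥0)).comp h1
  refine map_prodMk_restrict_eq_prod (fun _ => x) (measurable_stopped hT) (measurable_shift hT) ?_
  intro I J v u
  have hI := measurableSet_cylinder I v
  have hJ := measurableSet_cylinder J u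
  have hmE : ∀ n, MeasurableSet {w | firstPassageTime coord A w < ∞ ∧ w.1 (gridAbove n (T w)) = y ∧
      stopped (gridAbove n (T w)) w ∈ cylinder I v} := fun n =>
    (measurableSet_lt (measurable_firstPassageTime A) measurable_const).inter
      ((measurable_coord_comp (hgrid n) measurable_id (measurableSet_singleton y)).inter
        (measurable_stopped (hgrid n) hI))
  have lim₁ := tendsto_measure_of_tendsto_indicator_of_isFiniteMeasure atTop (Q x)
    (A := E ∩ (fun w => stopped (T w) w) ⁻¹' cylinder I v) hmE (fun w => by
      filter_upwards [eventually_coord_eq (w := w) (tendsto_gridAbove (T w)),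
        eventually_stopped_mem_cylinder_iff I v w (tendsto_gridAbove (T w))] with n h1 h2
      simp only [Set.mem_ofPred_eq, h1, h2, E, Set.mem_inter_iff, Set.mem_preimage, and_assoc])
  have lim₂ := tendsto_measure_of_tendsto_indicator_of_isFiniteMeasure atTop (Q x)
    (A := E ∩ (fun w => stopped (T w) w) ⁻¹' cylinder I v ∩ (fun w => shift (T w) w) ⁻¹' cylinder J u)
    (fun n => (hmE n).inter (measurable_shift (hgrid n) hJ)) (fun w => by
      filter_upwards [eventually_coord_eq (w := w) (tendsto_gridAbove (T w)),
        eventually_stopped_mem_cylinder_iff I v w (tendsto_gridAbove (T w)),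
        eventually_shift_mem_cylinder_iff J u w (tendsto_gridAbove (T w))] with n h1 h2 h3
      simp only [Set.mem_ofPred_eq, h1, h2, h3, E, Set.mem_inter_iff, Set.mem_preimage, and_assoc])
  -- For each mesh the joint probability is the probability of the past event times a constant, so
  -- both sides have the same limit.
  refine tendsto_nhds_unique lim₂ ?_
  refine (ENNReal.Tendsto.mul_const lim₁ (Or.inr (measure_ne_top _ _))).congr fun n => ?_
  exact (measure_gridAbove_inter_stopped_inter_shift hQ A x y n hI hJ).symm

/-! ### Decomposition of the drawdown payoff at the first passage time -/

lemma firstPassageTime_le {A : Set ℝ} {w : PathSpace S} {t : ℝ≥0} (ht : 0 < t)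
    (hA : (w.1 t : ℝ) ∉ A) : firstPassageTime coord A w ≤ t :=
  iInf₂_le t ⟨ht, hA⟩

/-- The path is constant just after `t`, and exit times occur there by definition of the infimum. -/
lemma coord_firstPassageTime_notMem {A : Set ℝ} {w : PathSpace S} {t : ℝ≥0}
    (h : firstPassageTime coord A w = t) : (w.1 t : ℝ) ∉ A := by
  obtain ⟨r, hr, hconst⟩ := exists_lt_forall_eq w t
  obtain ⟨u, hu0, huA, hur⟩ := firstPassageTime_lt_iff.1 (h.trans_lt (ENNReal.coe_lt_coe.2 hr))
  have htu : t ≤ u := ENNReal.coe_le_coe.1 (h ▸ firstPassageTime_le hu0 huA)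
  rwa [hconst u htu (ENNReal.coe_lt_coe.1 hur)] at huA

lemma firstPassageTime_pos {A : Set ℝ} {w : PathSpace S} {t : ℝ≥0} (h0 : (w.1 0 : ℝ) ∈ A)
    (h : firstPassageTime coord A w = t) : 0 < t := by
  rcases eq_or_ne t 0 with rfl | ht
  · exact absurd h0 (coord_firstPassageTime_notMem h)
  · exact pos_iff_ne_zero.2 ht

lemma coord_mem_of_lt_firstPassageTime {A : Set ℝ} {w : PathSpace S} {u : ℝ≥0}
    (h0 : (w.1 0 : ℝ) ∈ A) (h : (u : ℝ≥0∞) < firstPassageTime coord A w) : (w.1 u : ℝ) ∈ A := by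
  rcases eq_or_ne u 0 with rfl | hu
  · exact h0
  · by_contra hA
    exact absurd (firstPassageTime_le (pos_iff_ne_zero.2 hu) hA) (not_le.2 h)

/-- Starting inside `A` forces `t > 0`, so that the exit at `t`, which the stopped path retains,
counts as a passage. -/
lemma firstPassageTime_stopped {A : Set ℝ} {w : PathSpace S} {t : ℝ≥0} (h0 : (w.1 0 : ℝ) ∈ A)
    (h : firstPassageTime coord A w = t) : firstPassageTime coord A (stopped t w) = t := by
  refine le_antisymm (firstPassageTime_le (firstPassageTime_pos h0 h) ?_) ?_
  · rw [stopped_apply, min_self]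
    exact coord_firstPassageTime_notMem h
  · refine not_lt.1 fun hlt => ?_
    rw [firstPassageTime_stopped_lt_iff A w le_rfl, h] at hlt
    exact lt_irrefl _ hlt

lemma drawdownTime_le {a : ℝ} {w : PathSpace S} {t u : ℝ≥0} (hut : u ≤ t)
    (h : a ≤ (w.1 u : ℝ) - (w.1 t : ℝ)) : drawdownTime coord a w ≤ t :=
  iInf₂_le t (le_runningMax_sub_iff.2 ⟨u, hut, h⟩)

/-- A path that stays in `(x - a, x]` has no drawdown of size `a`. -/
lemma firstPassageTime_le_drawdownTime {a x : ℝ} {w : PathSpace S}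
    (h0 : (w.1 0 : ℝ) ∈ Set.Ioc (x - a) x) :
    firstPassageTime coord (Set.Ioc (x - a) x) w ≤ drawdownTime coord a w := by
  refine not_lt.1 fun hlt => ?_
  obtain ⟨t, u, hut, hau, ht⟩ := drawdownTime_lt_iff.1 hlt
  have h1 := coord_mem_of_lt_firstPassageTime h0 ht
  have h2 := coord_mem_of_lt_firstPassageTime h0 ((ENNReal.coe_le_coe.2 hut).trans_lt ht)
  linarith [h1.1, h2.2]

lemma drawdownTime_eq_of_coord_le {a x : ℝ} {w : PathSpace S} {t : ℝ≥0} (ha : 0 < a)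
    (h0 : (w.1 0 : ℝ) = x) (h : firstPassageTime coord (Set.Ioc (x - a) x) w = t)
    (ht : (w.1 t : ℝ) ≤ x - a) : drawdownTime coord a w = t := by
  refine le_antisymm (drawdownTime_le zero_le (by linarith)) ?_
  rw [← h]
  exact firstPassageTime_le_drawdownTime (by rw [h0]; exact ⟨by linarith, le_rfl⟩)

/-- If the path leaves `(x - a, x]` at a new maximum, the drawdown starts afresh. -/
lemma drawdownTime_eq_add_of_lt_coord {a x : ℝ} {w : PathSpace S} {t : ℝ≥0} (ha : 0 < a)
    (h0 : (w.1 0 : ℝ) = x) (h : firstPassageTime coord (Set.Ioc (x - a) x) w = t)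
    (ht : x < (w.1 t : ℝ)) : drawdownTime coord a w = t + drawdownTime coord a (shift t w) := by
  have hmem : (w.1 0 : ℝ) ∈ Set.Ioc (x - a) x := by rw [h0]; exact ⟨by linarith, le_rfl⟩
  refine le_antisymm (le_of_forall_gt fun r hr => ?_) (le_of_forall_gt fun r hr => ?_)
  · rw [← lt_tsub_iff_left] at hr
    obtain ⟨t₂, u, hut, hau, ht₂⟩ := drawdownTime_lt_iff.1 hr
    rw [lt_tsub_iff_left, ← ENNReal.coe_add] at ht₂
    exact (drawdownTime_le (add_le_add_right hut t) hau).trans_lt ht₂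
  · obtain ⟨t₁, u, hut, hau, ht₁⟩ := drawdownTime_lt_iff.1 hr
    have htt : t ≤ t₁ := by
      rw [← ENNReal.coe_le_coe, ← h]
      exact (firstPassageTime_le_drawdownTime hmem).trans (drawdownTime_le hut hau)
    obtain ⟨t₂, rfl⟩ := exists_add_of_le htt
    have : drawdownTime coord a (shift t w) ≤ t₂ := by
      -- If the high point `u` precedes `t`, its value is at most the value at `t`, so the initial
      -- time of the shifted path can replace it.
      rcases le_total t u with htu | hut'
      · obtain ⟨u₂, rfl⟩ := exists_add_of_le htu
        exact drawdownTime_le (le_of_add_le_add_left hut) hau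
      · refine drawdownTime_le zero_le (hau.trans (sub_le_sub_right ?_ _))
        rw [shift_apply, add_zero]
        rcases hut'.eq_or_lt with rfl | hlt
        · exact le_rfl
        · have := coord_mem_of_lt_firstPassageTime hmem (h ▸ ENNReal.coe_lt_coe.2 hlt)
          exact this.2.trans ht.le
    refine lt_of_le_of_lt ?_ ht₁
    rw [ENNReal.coe_add]
    gcongr

lemma discountedPayoff_of_eq_coe {T : PathSpace S → ℝ≥0∞} {k f : S → ℂ} {w : PathSpace S} {t : ℝ≥0}
    (h : T w = t) : discountedPayoff coord T k f w =
      Complex.exp (-∫ s in (0 : ℝ)..t, k (w.1 s.toNNReal)) * f (w.1 t) := by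
  rw [discountedPayoff, if_pos (h ▸ ENNReal.coe_lt_top), h, ENNReal.coe_toReal,
    ENNReal.toNNReal_coe]

lemma discountedPayoff_of_eq_top {T : PathSpace S → ℝ≥0∞} {k f : S → ℂ} {w : PathSpace S}
    (h : T w = ∞) : discountedPayoff coord T k f w = 0 := by
  rw [discountedPayoff, if_neg (by rw [h]; exact lt_irrefl _)]

lemma integral_discount_shift (k : S → ℂ) (w : PathSpace S) (t r : ℝ≥0) :
    ∫ s in (0 : ℝ)..(t + r : ℝ≥0), k (w.1 s.toNNReal) =
      (∫ s in (0 : ℝ)..t, k (w.1 s.toNNReal)) +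
        ∫ s in (0 : ℝ)..r, k ((shift t w).1 s.toNNReal) := by
  rw [← intervalIntegral.integral_add_adjacent_intervals (intervalIntegrable_discount k w 0 t)
    (intervalIntegrable_discount k w t _)]
  congr 1
  have h := intervalIntegral.integral_comp_add_left (a := 0) (b := r)
    (fun s : ℝ => k (w.1 s.toNNReal)) t
  rw [add_zero, ← NNReal.coe_add] at h
  rw [← h]
  refine intervalIntegral.integral_congr fun s hs => ?_
  rw [Set.uIcc_of_le r.coe_nonneg] at hs
  simp only [shift_apply]
  rw [Real.toNNReal_add t.coe_nonneg hs.1, Real.toNNReal_coe]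

lemma discountedPayoff_drawdownTime_of_lt_coord {a x : ℝ} {w : PathSpace S} {t : ℝ≥0} (ha : 0 < a)
    (k f : S → ℂ) (h0 : (w.1 0 : ℝ) = x) (h : firstPassageTime coord (Set.Ioc (x - a) x) w = t)
    (ht : x < (w.1 t : ℝ)) :
    discountedPayoff coord (drawdownTime coord a) k f w =
      Complex.exp (-∫ s in (0 : ℝ)..t, k (w.1 s.toNNReal)) *
        discountedPayoff coord (drawdownTime coord a) k f (shift t w) := by
  have hτ := drawdownTime_eq_add_of_lt_coord ha h0 h ht
  rcases eq_or_ne (drawdownTime coord a (shift t w)) ∞ with htop | hfin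
  · rw [htop, add_top] at hτ
    rw [discountedPayoff_of_eq_top htop, discountedPayoff_of_eq_top hτ, mul_zero]
  · obtain ⟨r, hr⟩ := WithTop.ne_top_iff_exists.1 hfin
    have hr' : drawdownTime coord a (shift t w) = (r : ℝ≥0∞) := hr.symm
    rw [hr', ← ENNReal.coe_add] at hτ
    rw [discountedPayoff_of_eq_coe hr', discountedPayoff_of_eq_coe hτ, integral_discount_shift,
      neg_add, Complex.exp_add, shift_apply, mul_assoc]

/-- This makes the payoff up to the passage a function of the past, as needed for the product law in
`strongMarkov`. -/
lemma discountedPayoff_firstPassageTime_stopped {A : Set ℝ} {w : PathSpace S} {t : ℝ≥0} (k g : S → ℂ)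
    (h0 : (w.1 0 : ℝ) ∈ A) (h : firstPassageTime coord A w = t) :
    discountedPayoff coord (firstPassageTime coord A) k g (stopped t w) =
      discountedPayoff coord (firstPassageTime coord A) k g w := by
  rw [discountedPayoff_of_eq_coe h, discountedPayoff_of_eq_coe (firstPassageTime_stopped h0 h),
    stopped_apply, min_self]
  congr 3
  refine intervalIntegral.integral_congr fun s hs => ?_
  rw [Set.uIcc_of_le t.coe_nonneg] at hs
  simp only [stopped_apply]
  rw [min_eq_left (Real.toNNReal_le_iff_le_coe.2 hs.2)]

/-- The event that the first passage time is finite and the path is then in the state `y`. -/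
def passageEvent (A : Set ℝ) (y : S) : Set (PathSpace S) :=
  {w | firstPassageTime coord A w < ∞ ∧ w.1 (firstPassageTime coord A w).toNNReal = y}

lemma measurableSet_passageEvent (A : Set ℝ) (y : S) : MeasurableSet (passageEvent A y) :=
  (measurableSet_lt (measurable_firstPassageTime A) measurable_const).inter
    (measurable_coord_comp (measurable_firstPassageTime A).ennreal_toNNReal measurable_id
      (measurableSet_singleton y))

lemma discountedPayoff_eq_zero_of_notMem_passageEvent {A : Set ℝ} {y : S} (k : S → ℂ)
    {w : PathSpace S} (hw : w ∉ passageEvent A y) :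
    discountedPayoff coord (firstPassageTime coord A) k (({y} : Set S).indicator fun _ => 1) w = 0 := by
  rw [discountedPayoff]
  split_ifs with h
  · rw [Set.indicator_of_notMem, mul_zero]
    exact fun hy => hw ⟨h, hy⟩
  · rfl

/-- The cases are no exit, exit at or below `x - a`, and exit above `x`; in the last one only the
summand of the state reached survives. Each summand is a function of the past times a function of
the future. -/
lemma discountedPayoff_drawdownTime_eq {a : ℝ} (ha : 0 < a) (k f : S → ℂ) {x : S} {w : PathSpace S}
    (h0 : w.1 0 = x) :
    let A := Set.Ioc ((x : ℝ) - a) x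
    let T := fun w : PathSpace S => (firstPassageTime coord A w).toNNReal
    discountedPayoff coord (drawdownTime coord a) k f w =
      discountedPayoff coord (firstPassageTime coord A) k ({z : S | (z : ℝ) ≤ x - a}.indicator f) w +
        ∑ y ∈ Finset.univ.filter (fun y : S => (x : ℝ) < y),
          (passageEvent A y).indicator (fun w =>
            discountedPayoff coord (firstPassageTime coord A) k (({y} : Set S).indicator fun _ => 1)
                (stopped (T w) w) *
              discountedPayoff coord (drawdownTime coord a) k f (shift (T w) w)) w := by
  intro A T
  have h0' : (w.1 0 : ℝ) = x := by rw [h0]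
  have hmem : (w.1 0 : ℝ) ∈ A := by rw [h0']; exact ⟨by linarith, le_rfl⟩
  rcases eq_or_ne (firstPassageTime coord A w) ∞ with htop | hfin
  · have hτ : drawdownTime coord a w = ∞ :=
      top_le_iff.1 (htop ▸ firstPassageTime_le_drawdownTime hmem)
    rw [discountedPayoff_of_eq_top htop, discountedPayoff_of_eq_top hτ, zero_add]
    refine (Finset.sum_eq_zero fun y _ => Set.indicator_of_notMem ?_ _).symm
    rintro ⟨h, -⟩
    exact h.ne htop
  obtain ⟨t, ht⟩ := WithTop.ne_top_iff_exists.1 hfin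
  replace ht : firstPassageTime coord A w = (t : ℝ≥0∞) := ht.symm
  have hTt : T w = t := by simp only [T, ht, ENNReal.toNNReal_coe]
  have hev : ∀ y, w ∈ passageEvent A y ↔ w.1 t = y := fun y => by
    refine (and_iff_right (ht ▸ ENNReal.coe_lt_top)).trans ?_
    rw [ht, ENNReal.toNNReal_coe]
  have hnot := coord_firstPassageTime_notMem ht
  rcases le_or_gt (w.1 t : ℝ) (x - a) with hle | hgt
  · rw [discountedPayoff_of_eq_coe (drawdownTime_eq_of_coord_le ha h0' ht hle),
      discountedPayoff_of_eq_coe ht,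
      Set.indicator_of_mem (show w.1 t ∈ {z : S | (z : ℝ) ≤ x - a} from hle), left_eq_add]
    refine Finset.sum_eq_zero fun y hy => Set.indicator_of_notMem ?_ _
    rw [hev]
    rintro rfl
    have := (Finset.mem_filter.1 hy).2
    linarith
  · have hlt : (x : ℝ) < w.1 t := lt_of_not_ge fun hle => hnot ⟨hgt, hle⟩
    rw [discountedPayoff_of_eq_coe (f := Set.indicator _ f) ht,
      Set.indicator_of_notMem (show w.1 t ∉ {z : S | (z : ℝ) ≤ x - a} from not_le.2 hgt),
      mul_zero, zero_add,
      Finset.sum_eq_single_of_mem (w.1 t) (Finset.mem_filter.2 ⟨Finset.mem_univ _, hlt⟩),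
      Set.indicator_of_mem ((hev _).2 rfl), hTt,
      discountedPayoff_firstPassageTime_stopped k _ hmem ht, discountedPayoff_of_eq_coe ht,
      Set.indicator_of_mem (Set.mem_singleton _), mul_one,
      discountedPayoff_drawdownTime_of_lt_coord ha k f h0' ht hlt]
    intro y _ hy
    exact Set.indicator_of_notMem (fun h => hy ((hev y).1 h).symm) _

/-- The strong Markov property applied to the drawdown payoff after the first passage. -/
lemma integral_passageEvent_mul (hQ : IsMarkovChain G Q coord) {a : ℝ} {A : Set ℝ} {k : S → ℂ}
    (hk : ∀ z, 0 ≤ (k z).re) (f : S → ℂ) {x : S} (hx : (x : ℝ) ∈ A) (y : S) :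
    let T := fun w : PathSpace S => (firstPassageTime coord A w).toNNReal
    let H := (passageEvent A y).indicator (fun w =>
      discountedPayoff coord (firstPassageTime coord A) k (({y} : Set S).indicator fun _ => 1)
          (stopped (T w) w) *
        discountedPayoff coord (drawdownTime coord a) k f (shift (T w) w))
    Integrable H (Q x) ∧ ∫ w, H w ∂(Q x) =
      passageValue Q coord A k x (({y} : Set S).indicator fun _ => 1) *
        drawdownValue Q coord a f k y := by
  intro T H
  have := hQ.isProbabilityMeasure
  have hT : Measurable T := (measurable_firstPassageTime A).ennreal_toNNReal
  have hE := measurableSet_passageEvent A y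
  have hst := measurable_stopped hT
  have hsh := measurable_shift hT
  have hm₁ := measurable_discountedPayoff k (({y} : Set S).indicator fun _ => 1)
    (measurable_firstPassageTime A)
  have hint := (integrable_discountedPayoff hk (({y} : Set S).indicator fun _ => 1)
      (measurable_firstPassageTime A)
      (((Q x).restrict (passageEvent A y)).map fun w => stopped (T w) w)).mul_prod
    (integrable_discountedPayoff hk f (measurable_drawdownTime a) (Q y))
  have hval := integral_prod_mul
    (μ := ((Q x).restrict (passageEvent A y)).map fun w => stopped (T w) w) (ν := Q y)
    (discountedPayoff coord (firstPassageTime coord A) k (({y} : Set S).indicator fun _ => 1))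
    (discountedPayoff coord (drawdownTime coord a) k f)
  have hprod : ((Q x).restrict (passageEvent A y)).map (fun w => (stopped (T w) w, shift (T w) w)) =
      (((Q x).restrict (passageEvent A y)).map fun w => stopped (T w) w).prod (Q y) :=
    strongMarkov hQ A x y
  rw [← hprod] at hint hval
  constructor
  · rw [integrable_indicator_iff hE]
    exact hint.comp_measurable (hst.prodMk hsh)
  · rw [integral_map (hst.prodMk hsh).aemeasurable
        hint.aestronglyMeasurable,
      integral_map hst.aemeasurable hm₁.aestronglyMeasurable] at hval
    rw [integral_indicator hE, hval, passageValue, drawdownValue]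
    congr 1
    -- The indicator payoff vanishes off the passage event, so the passage value is an integral over
    -- that event, where stopping does not change the payoff.
    rw [← setIntegral_eq_integral_of_forall_compl_eq_zero (s := passageEvent A y)
      fun w hw => discountedPayoff_eq_zero_of_notMem_passageEvent k hw]
    refine setIntegral_congr_ae hE ?_
    filter_upwards [ae_coord_zero hQ x] with w hw hwE
    exact discountedPayoff_firstPassageTime_stopped k _ (by rw [hw]; exact hx)
      (ENNReal.coe_toNNReal hwE.1.ne).symm

lemma drawdownValue_eq (hQ : IsMarkovChain G Q coord) {a : ℝ} (ha : 0 < a) (f : S → ℂ) {k : S → ℂ}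
    (hk : ∀ z, 0 ≤ (k z).re) (x : S) :
    drawdownValue Q coord a f k x =
      passageValue Q coord (Set.Ioc ((x : ℝ) - a) x) k x ({z : S | (z : ℝ) ≤ x - a}.indicator f) +
        ∑ y ∈ Finset.univ.filter (fun y : S => (x : ℝ) < y),
          passageValue Q coord (Set.Ioc ((x : ℝ) - a) x) k x (({y} : Set S).indicator fun _ => 1) *
            drawdownValue Q coord a f k y := by
  have := hQ.isProbabilityMeasure
  have hx : (x : ℝ) ∈ Set.Ioc ((x : ℝ) - a) x := ⟨by linarith, le_rfl⟩
  have hmain := integral_passageEvent_mul hQ (a := a) hk f hx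
  rw [drawdownValue, integral_congr_ae ((ae_coord_zero hQ x).mono fun w hw =>
      discountedPayoff_drawdownTime_eq ha k f hw),
    integral_add (integrable_discountedPayoff hk _ (measurable_firstPassageTime _) _)
      (integrable_finsetSum _ fun y _ => (hmain y).1),
    integral_finsetSum _ fun y _ => (hmain y).1]
  congr 1
  exact Finset.sum_congr rfl fun y _ => (hmain y).2

end PathSpace

/-! ### Transfer from the path space to a general probability space. -/

/-- The path of a Markov chain as an element of the path space. -/
def IsMarkovChain.path {Ω : Type*} [MeasurableSpace Ω] {S : Finset ℝ} {G : Matrix S S ℝ}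
    {P : S → Measure Ω} {Y : ℝ≥0 → Ω → S} (hY : IsMarkovChain G P Y) (ω : Ω) : PathSpace S :=
  ⟨fun t => Y t ω, hY.rightContinuous ω⟩

lemma IsMarkovChain.measurable_path {Ω : Type*} [MeasurableSpace Ω] {S : Finset ℝ}
    {G : Matrix S S ℝ} {P : S → Measure Ω} {Y : ℝ≥0 → Ω → S} (hY : IsMarkovChain G P Y) :
    Measurable hY.path :=
  Measurable.subtype_mk (measurable_pi_lambda _ hY.measurable)

/-- The coordinate process is a Markov chain under the laws of the paths of a Markov chain. -/
lemma IsMarkovChain.isMarkovChain_coord {Ω : Type*} [MeasurableSpace Ω] {S : Finset ℝ}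
    {G : Matrix S S ℝ} {P : S → Measure Ω} {Y : ℝ≥0 → Ω → S} (hY : IsMarkovChain G P Y) :
    IsMarkovChain G (fun x => (P x).map hY.path) PathSpace.coord where
  isProbabilityMeasure x :=
    have := hY.isProbabilityMeasure x
    Measure.isProbabilityMeasure_map hY.measurable_path.aemeasurable
  measurable := PathSpace.measurable_coord
  rightContinuous w := w.2
  finiteDimensional x n t y ht h0 := by
    rw [map_measureReal_apply hY.measurable_path]
    · exact hY.finiteDimensional x n t y ht h0
    · have : {w : PathSpace S | ∀ i, PathSpace.coord (t i) w = y i} =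
          ⋂ i, {w | w.1 (t i) ∈ ({y i} : Set S)} := by
        ext w; simp
      rw [this]
      exact MeasurableSet.iInter fun i => PathSpace.measurableSet_coord_mem _ _

end CTMC

theorem mainTheorem3 {Ω : Type*} [MeasurableSpace Ω] {S : Finset ℝ}
    (G : Matrix S S ℝ) (hG : CTMC.IsRateMatrix G)
    (P : S → Measure Ω) (Y : ℝ≥0 → Ω → S) (hY : CTMC.IsMarkovChain G P Y)
    (a : ℝ) (ha : 0 < a) (f : S → ℂ) (k : S → ℂ) (hk : ∀ x, 0 ≤ (k x).re) (x : S) :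
    -- all expectations that occur below are expectations of integrable random variables
    ((∀ y : S, Integrable (CTMC.discountedPayoff Y (CTMC.drawdownTime Y a) k f) (P y)) ∧
      (∀ g : S → ℂ, Integrable
        (CTMC.discountedPayoff Y
          (CTMC.firstPassageTime Y (Set.Ioc ((x : ℝ) - a) (x : ℝ))) k g) (P x))) ∧
    -- the linear system
    CTMC.drawdownValue P Y a f k x =
      CTMC.passageValue P Y (Set.Ioc ((x : ℝ) - a) (x : ℝ)) k x
          ({z : S | (z : ℝ) ≤ (x : ℝ) - a}.indicator f) +
        ∑ y ∈ Finset.univ.filter (fun y : S => (x : ℝ) < (y : ℝ)),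
          CTMC.passageValue P Y (Set.Ioc ((x : ℝ) - a) (x : ℝ)) k x
              (({y} : Set S).indicator fun _ => 1) *
            CTMC.drawdownValue P Y a f k y := by
  have hQ := hY.isMarkovChain_coord
  have hτ := CTMC.PathSpace.measurable_drawdownTime (S := S) a
  have hT := CTMC.PathSpace.measurable_firstPassageTime (S := S) (Set.Ioc ((x : ℝ) - a) x)
  -- The functionals of `Y` are those of the coordinate process composed with the path map, so the
  -- expectations agree by change of variables.
  have hB : ∀ y, CTMC.drawdownValue (fun x => (P x).map hY.path) CTMC.PathSpace.coord a f k y =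
      CTMC.drawdownValue P Y a f k y := fun y =>
    integral_map hY.measurable_path.aemeasurable
      (CTMC.PathSpace.measurable_discountedPayoff k f hτ).aestronglyMeasurable
  have hP : ∀ g, CTMC.passageValue (fun x => (P x).map hY.path) CTMC.PathSpace.coord
      (Set.Ioc ((x : ℝ) - a) x) k x g = CTMC.passageValue P Y (Set.Ioc ((x : ℝ) - a) x) k x g :=
    fun g => integral_map hY.measurable_path.aemeasurable
      (CTMC.PathSpace.measurable_discountedPayoff k g hT).aestronglyMeasurable
  have hint : ∀ (g : S → ℂ) {T : CTMC.PathSpace S → ℝ≥0∞}, Measurable T → ∀ y,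
      Integrable (CTMC.discountedPayoff CTMC.PathSpace.coord T k g ∘ hY.path) (P y) :=
    fun g T hT y =>
      have : IsProbabilityMeasure ((P y).map hY.path) := hQ.isProbabilityMeasure y
      (CTMC.PathSpace.integrable_discountedPayoff hk g hT ((P y).map hY.path)).comp_measurable
        hY.measurable_path
  refine ⟨⟨fun y => hint f hτ y, fun g => hint g hT x⟩, ?_⟩
  simpa only [hB, hP] using CTMC.PathSpace.drawdownValue_eq hQ ha f hk x
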